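/- **Setting.** Greek indices $\alpha,\beta,\gamma,\delta$ take the values $1,2$, Latin indices $i,j,k,l$ the values $3,4$; repeated indices are summed. Let $M$ be a smooth 4-manifold with an almost Grassmann structure $AG(1,3)$, that is, a smooth field of Segre cones $SC_x\subset T_xM$: near every point there is a smooth coframe $(\omega_\alpha^i)$ in which $SC_x=\{z : z_\alpha^i=t_\alpha s^i \text{ for some } t,s\in\mathbb R^2\}$ (an adapted coframe). Let $\pi:N\to M$ be a smooth submersion, each point of $N$ carrying an adapted frame at its image in $M$ (for instance the bundle of second-order frames of the structure, or $M$ itself with a chosen smooth field of adapted frames), and let $\omega_\alpha^i$ be the components of $d\pi$ in these frames. Suppose that on $N$ there are smooth 1-forms $\omega_\alpha^\beta,\ \omega_j^i,\ \omega,\ \omega_i^\alpha$ with $\omega_\gamma^\gamma=0$, $\omega_k^k=0$ satisfying, together with the smooth forms $\omega_\alpha^i$, the structure equations of the normal connection: $$d\omega_\alpha^i-\omega_\alpha^j\wedge\omega_j^i-\omega_\alpha^\beta\wedge\omega_\beta^i-\omega\wedge\omega_\alpha^i=a_{\alpha jk}^{i\beta\gamma}\,\omega_\beta^j\wedge\omega_\gamma^k,$$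 $$d\omega_\alpha^\beta-\omega_\alpha^\gamma\wedge\omega_\gamma^\beta=\tfrac12\bigl(\delta_\alpha^\beta\,\omega_\gamma^k\wedge\omega_k^\gamma-2\,\omega_\alpha^k\wedge\omega_k^\beta\bigr)+b_{\alpha kl}^{\beta\gamma\delta}\,\omega_\gamma^k\wedge\omega_\delta^l,$$ $$d\omega_j^i-\omega_j^k\wedge\omega_k^i=\tfrac12\bigl(\delta_j^i\,\omega_k^\gamma\wedge\omega_\gamma^k-2\,\omega_j^\gamma\wedge\omega_\gamma^i\bigr)+b_{jkl}^{i\gamma\delta}\,\omega_\gamma^k\wedge\omega_\delta^l,$$ $$d\omega=\omega_i^\alpha\wedge\omega_\alpha^i,$$ $$d\omega_i^\alpha-\omega_i^\beta\wedge\omega_\beta^\alpha-\omega_i^j\wedge\omega_j^\alpha+\omega\wedge\omega_i^\alpha=c_{ijk}^{\alpha\beta\gamma}\,\omega_\gamma^k\wedge\omega_\beta^j-a_{\gamma ij}^{k\alpha\beta}\,\omega_k^\gamma\wedge\omega_\beta^j .$$ Here the coefficients are skew-symmetric in their two pairs of indices ($a_{\alpha jk}^{i\beta\gamma}=-a_{\alpha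 kj}^{i\gamma\beta}$, $b_{\alpha kl}^{\beta\gamma\delta}=-b_{\alpha lk}^{\beta\delta\gamma}$, $b_{jkl}^{i\gamma\delta}=-b_{jlk}^{i\delta\gamma}$, $c_{ijk}^{\alpha\beta\gamma}=-c_{ikj}^{\alpha\gamma\beta}$), and the connection is normalized by $$a_{\alpha jk}^{i\alpha\gamma}=0,\qquad a_{\alpha ik}^{i\beta\gamma}=0,\qquad b_{\alpha kl}^{\gamma\alpha\delta}-b_{kil}^{i\gamma\delta}+b_{\alpha lk}^{\delta\alpha\gamma}-b_{lik}^{i\delta\gamma}=0 .$$ The curvature tensor of the structure is $b=(b^1,b^2)$ with $b^1=\{b_{jkl}^{i\gamma\delta}\}$, $b^2=\{b_{\alpha kl}^{\beta\gamma\delta}\}$. **Theorem.** At every point the components of $b$ satisfy $$b_{233}^{121}=b_{334}^{411}=b_{133}^{212}=b_{334}^{422}=b_{244}^{121}=b_{443}^{311}=b_{144}^{212}=b_{443}^{322}=0,$$ $$b_{133}^{112}=b_{144}^{112}=b_{443}^{411}=b_{334}^{322}=0,$$ $$b_{343}^{412}=b_{433}^{412}=b_{334}^{412},\qquad b_{443}^{321}=b_{344}^{321}=b_{434}^{321},$$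 $$b_{243}^{211}=b_{243}^{112}=b_{243}^{121},\qquad b_{134}^{122}=b_{134}^{221}=b_{134}^{212},$$ $$b_{134}^{112}=b_{134}^{211}=b_{134}^{121}=b_{243}^{122},\qquad b_{433}^{321}=b_{334}^{321}=b_{343}^{321}=b_{344}^{412}.$$ Moreover, $b$ has exactly 10 linearly independent components: the values of $b$ in adapted frames, for all $AG(1,3)$-structures and all points, span a vector space of dimension exactly 10. -/

import Mathlib

open scoped Manifold ContDiff Topology

noncomputable section

/-! ### Differential 1-forms on a manifold modelled on `ℝᵐ` -/

/-- A (not necessarily smooth) field of covectors on `N`. -/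
abbrev OneForm (m : ℕ) (N : Type*) [TopologicalSpace N]
    [ChartedSpace (EuclideanSpace ℝ (Fin m)) N] :=
  ∀ x : N, TangentSpace (𝓡 m) x →L[ℝ] ℝ

namespace OneForm

variable {m : ℕ} {N : Type*} [TopologicalSpace N] [ChartedSpace (EuclideanSpace ℝ (Fin m)) N]

/-- The expression of `θ` in the preferred chart around `x₀`, that is, the pullback of `θ` by the
inverse of the chart. It is meaningful on the target of the chart. -/
def inChart (θ : OneForm m N) (x₀ : N) (y : EuclideanSpace ℝ (Fin m)) :
    EuclideanSpace ℝ (Fin m) →L[ℝ] ℝ :=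
  (θ ((extChartAt (𝓡 m) x₀).symm y)).comp
    (mfderiv 𝓘(ℝ, EuclideanSpace ℝ (Fin m)) (𝓡 m) (extChartAt (𝓡 m) x₀).symm y)

/-- Smoothness (`C^∞`) of a 1-form on a set `U`, in charts. -/
def SmoothOn (θ : OneForm m N) (U : Set N) : Prop :=
  ∀ x₀ : N, ContDiffOn ℝ ∞ (θ.inChart x₀)
    ((extChartAt (𝓡 m) x₀).target ∩ (extChartAt (𝓡 m) x₀).symm ⁻¹' U)

/-- Smoothness (`C^∞`) of a 1-form on the whole manifold. -/
def Smooth (θ : OneForm m N) : Prop := θ.SmoothOn Set.univ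

/-- The exterior derivative `dθ` of a 1-form at `x`, evaluated on `u, v ∈ T_x N`: the exterior
derivative of the expression of `θ` in the preferred chart at `x`. (In Mathlib `T_x N` is the model
space, the identification being the derivative of that same chart.) Since the exterior derivative
commutes with pullbacks, the result does not depend on the chart. The normalization is
`dθ(X, Y) = X(θ(Y)) - Y(θ(X)) - θ([X, Y])`. -/
def extD (θ : OneForm m N) (x : N) (u v : TangentSpace (𝓡 m) x) : ℝ :=
  extDeriv
    (fun y => ContinuousAlternatingMap.ofSubsingleton ℝ (EuclideanSpace ℝ (Fin m)) ℝ (0 : Fin 1)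
      (θ.inChart x y))
    (extChartAt (𝓡 m) x x) ![(u : EuclideanSpace ℝ (Fin m)), (v : EuclideanSpace ℝ (Fin m))]

/-- The wedge product of two 1-forms, `(θ ∧ η)(u, v) = θ(u) η(v) - θ(v) η(u)`. -/
def wedge (θ η : OneForm m N) (x : N) (u v : TangentSpace (𝓡 m) x) : ℝ :=
  θ x u * η x v - θ x v * η x u

end OneForm

/-! ### Almost Grassmann structures `AG(1,3)`

Greek indices `α, β, γ, δ` take the two values `1, 2`, Latin indices `i, j, k, l` the two values
`3, 4`. Both index sets are represented by `Fin 2`. Its numerals are read modulo 2, so that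
`(1 : Fin 2)` and `(2 : Fin 2)` are its two distinct elements, and so are `(3 : Fin 2)` and
`(4 : Fin 2)`: the customary index values can be written literally. -/

/-- The coordinates `z_α^i` of a tangent vector, written as `z α i`. -/
abbrev Coords : Type := Fin 2 → Fin 2 → ℝ

/-- A linear coordinate system `e : V ≃ (z_α^i)` is adapted to the cone `C ⊆ V` if `C` has the
equations `z_α^i = t_α s^i` (a Segre cone `SC(2,2)`) in these coordinates. -/
def IsAdaptedFrame {V : Type*} [AddCommGroup V] [Module ℝ V] (C : Set V)
    (e : V ≃ₗ[ℝ] Coords) : Prop :=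
  C = {v | ∃ t s : Fin 2 → ℝ, ∀ α i, e v α i = t α * s i}

/-- An almost Grassmann structure `AG(1,3)` on a 4-dimensional manifold `M`: a smooth field of
Segre cones `SC_x(2,2) ⊆ T_x M`. Smoothness means that locally there are smooth adapted coframes. -/
structure AlmostGrassmann13 (M : Type*) [TopologicalSpace M]
    [ChartedSpace (EuclideanSpace ℝ (Fin 4)) M] where
  cone : ∀ x : M, Set (TangentSpace (𝓡 4) x)
  exists_coframe : ∀ x₀ : M, ∃ U : Set M, IsOpen U ∧ x₀ ∈ U ∧
    ∃ θ : Fin 2 → Fin 2 → OneForm 4 M, (∀ α i, (θ α i).SmoothOn U) ∧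
      ∀ x ∈ U, ∃ e : TangentSpace (𝓡 4) x ≃ₗ[ℝ] Coords,
        (∀ v α i, e v α i = θ α i x v) ∧ IsAdaptedFrame (cone x) e

/-- Arrays of components with three lower and three upper indices, in the order
(lower, lower, lower, upper, upper, upper), such as `b_{αkl}^{βγδ} = b α k l β γ δ`. -/
abbrev Array6 : Type := Fin 2 → Fin 2 → Fin 2 → Fin 2 → Fin 2 → Fin 2 → ℝ

/-- Kronecker delta. -/
def kron (a b : Fin 2) : ℝ := if a = b then 1 else 0

open OneForm in
/-- The structure equations (normal Cartan connection) of an almost Grassmann structure `AG(1,3)`.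

The forms live on a manifold `N` with a submersion `π : N → M`, each point `n` of `N` carrying an
adapted frame of `T_{π n} M`. Examples are the bundle of second-order adapted frames, where the
forms are globally and canonically defined, and `M` itself or an open subset of it, where the forms
are the pullbacks of these under a local section. -/
structure AGStructureForms {M : Type*} [TopologicalSpace M]
    [ChartedSpace (EuclideanSpace ℝ (Fin 4)) M] (S : AlmostGrassmann13 M)
    (m : ℕ) (N : Type*) [TopologicalSpace N] [ChartedSpace (EuclideanSpace ℝ (Fin m)) N] where
  /-- the projection -/
  π : N → M
  contMDiff_π : ContMDiff (𝓡 m) (𝓡 4) ∞ π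
  submersion : ∀ n, Function.Surjective (mfderiv (𝓡 m) (𝓡 4) π n)
  /-- the adapted frame carried by the point `n` -/
  frame : ∀ n, TangentSpace (𝓡 4) (π n) ≃ₗ[ℝ] Coords
  adapted : ∀ n, IsAdaptedFrame (S.cone (π n)) (frame n)
  /-- the basis forms `ω_α^i = w α i` -/
  w : Fin 2 → Fin 2 → OneForm m N
  w_apply : ∀ n (v : TangentSpace (𝓡 m) n) (α i : Fin 2),
    w α i n v = frame n (mfderiv (𝓡 m) (𝓡 4) π n v) α i
  /-- the forms `ω_α^β = A α β` -/
  A : Fin 2 → Fin 2 → OneForm m N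
  /-- the forms `ω_j^i = B j i` -/
  B : Fin 2 → Fin 2 → OneForm m N
  /-- the scalar form `ω` -/
  o : OneForm m N
  /-- the forms `ω_i^α = z i α` -/
  z : Fin 2 → Fin 2 → OneForm m N
  smooth_w : ∀ α i, (w α i).Smooth
  smooth_A : ∀ α β, (A α β).Smooth
  smooth_B : ∀ j i, (B j i).Smooth
  smooth_o : o.Smooth
  smooth_z : ∀ i α, (z i α).Smooth
  trace_A : ∀ n v, ∑ γ, A γ γ n v = 0
  trace_B : ∀ n v, ∑ k, B k k n v = 0
  /-- the torsion `a_{αjk}^{iβγ} = a n α j k i β γ` -/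
  a : N → Array6
  /-- the part `b_{jkl}^{iγδ} = b₁ n j k l i γ δ` of the curvature tensor -/
  b₁ : N → Array6
  /-- the part `b_{αkl}^{βγδ} = b₂ n α k l β γ δ` of the curvature tensor -/
  b₂ : N → Array6
  /-- the quantities `c_{ijk}^{αβγ} = c n i j k α β γ` -/
  c : N → Array6
  /-- The coefficients of 2-forms are taken skew-symmetric in the two pairs of indices. -/
  a_skew : ∀ n α j k i β γ, a n α j k i β γ = - a n α k j i γ β
  b₁_skew : ∀ n j k l i γ δ, b₁ n j k l i γ δ = - b₁ n j l k i δ γ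
  b₂_skew : ∀ n α k l β γ δ, b₂ n α k l β γ δ = - b₂ n α l k β δ γ
  c_skew : ∀ n i j k α β γ, c n i j k α β γ = - c n i k j α γ β
  /-- `dω_α^i - ω_α^j ∧ ω_j^i - ω_α^β ∧ ω_β^i - ω ∧ ω_α^i = a_{αjk}^{iβγ} ω_β^j ∧ ω_γ^k` -/
  d_w : ∀ n u v (α i : Fin 2),
    (w α i).extD n u v - ∑ j, wedge (w α j) (B j i) n u v - ∑ β, wedge (A α β) (w β i) n u v
      - wedge o (w α i) n u v
    = ∑ j, ∑ k, ∑ β, ∑ γ, a n α j k i β γ * wedge (w β j) (w γ k) n u v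
  /-- `dω_α^β - ω_α^γ ∧ ω_γ^β
    = (1/2) (δ_α^β ω_γ^k ∧ ω_k^γ - 2 ω_α^k ∧ ω_k^β) + b_{αkl}^{βγδ} ω_γ^k ∧ ω_δ^l` -/
  d_A : ∀ n u v (α β : Fin 2),
    (A α β).extD n u v - ∑ γ, wedge (A α γ) (A γ β) n u v
    = (1 / 2) * (kron α β * (∑ γ, ∑ k, wedge (w γ k) (z k γ) n u v)
        - 2 * ∑ k, wedge (w α k) (z k β) n u v)
      + ∑ k, ∑ l, ∑ γ, ∑ δ, b₂ n α k l β γ δ * wedge (w γ k) (w δ l) n u v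
  /-- `dω_j^i - ω_j^k ∧ ω_k^i
    = (1/2) (δ_j^i ω_k^γ ∧ ω_γ^k - 2 ω_j^γ ∧ ω_γ^i) + b_{jkl}^{iγδ} ω_γ^k ∧ ω_δ^l` -/
  d_B : ∀ n u v (j i : Fin 2),
    (B j i).extD n u v - ∑ k, wedge (B j k) (B k i) n u v
    = (1 / 2) * (kron j i * (∑ k, ∑ γ, wedge (z k γ) (w γ k) n u v)
        - 2 * ∑ γ, wedge (z j γ) (w γ i) n u v)
      + ∑ k, ∑ l, ∑ γ, ∑ δ, b₁ n j k l i γ δ * wedge (w γ k) (w δ l) n u v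
  /-- `dω = ω_i^α ∧ ω_α^i` -/
  d_o : ∀ n u v, o.extD n u v = ∑ i, ∑ α, wedge (z i α) (w α i) n u v
  /-- `dω_i^α - ω_i^β ∧ ω_β^α - ω_i^j ∧ ω_j^α + ω ∧ ω_i^α
    = c_{ijk}^{αβγ} ω_γ^k ∧ ω_β^j - a_{γij}^{kαβ} ω_k^γ ∧ ω_β^j` -/
  d_z : ∀ n u v (i α : Fin 2),
    (z i α).extD n u v - ∑ β, wedge (z i β) (A β α) n u v - ∑ j, wedge (B i j) (z j α) n u v
      + wedge o (z i α) n u v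
    = (∑ j, ∑ k, ∑ β, ∑ γ, c n i j k α β γ * wedge (w γ k) (w β j) n u v)
      - ∑ j, ∑ k, ∑ β, ∑ γ, a n γ i j k α β * wedge (z k γ) (w β j) n u v
  /-- Normalization of the torsion, which fixes `ω_α^β, ω_j^i` for given `ω_α^i` and `ω`:
  `a_{αjk}^{iαγ} = 0` and `a_{αik}^{iβγ} = 0`. -/
  a_trace₁ : ∀ n j k i γ, ∑ α, a n α j k i α γ = 0
  a_trace₂ : ∀ n α k β γ, ∑ i, a n α i k i β γ = 0
  /-- Normalization of the curvature, which fixes `ω_i^α`; without it the structure equations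
  only determine `ω_i^α` up to adding `P_{ij}^{αβ} ω_β^j` with `P_{ij}^{αβ} = P_{ji}^{βα}`:
  `b_{αkl}^{γαδ} - b_{kil}^{iγδ} + b_{αlk}^{δαγ} - b_{lik}^{iδγ} = 0`. -/
  b_normal : ∀ n k l γ δ, (∑ α, b₂ n α k l γ α δ) - (∑ i, b₁ n k i l i γ δ)
    + (∑ α, b₂ n α l k δ α γ) - (∑ i, b₁ n l i k i δ γ) = 0

/-- The components of an array as one family indexed by sextuples of indices. -/
def Array6.components (b : Array6) : Fin 2 × Fin 2 × Fin 2 × Fin 2 × Fin 2 × Fin 2 → ℝ :=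
  fun p => b p.1 p.2.1 p.2.2.1 p.2.2.2.1 p.2.2.2.2.1 p.2.2.2.2.2

/-- The set of all values `b = (b¹, b²)` of the curvature tensor, in adapted frames, of all almost
Grassmann structures `AG(1,3)` at all points. -/
def curvatureValues :
    Set ((Fin 2 × Fin 2 × Fin 2 × Fin 2 × Fin 2 × Fin 2 → ℝ) ×
      (Fin 2 × Fin 2 × Fin 2 × Fin 2 × Fin 2 × Fin 2 → ℝ)) :=
  {b | ∃ (M : Type) (_ : TopologicalSpace M) (_ : ChartedSpace (EuclideanSpace ℝ (Fin 4)) M)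
      (_ : IsManifold (𝓡 4) ∞ M) (S : AlmostGrassmann13 M)
      (m : ℕ) (N : Type) (_ : TopologicalSpace N)
      (_ : ChartedSpace (EuclideanSpace ℝ (Fin m)) N) (_ : IsManifold (𝓡 m) ∞ N)
      (F : AGStructureForms S m N) (n : N),
      b = (Array6.components (F.b₁ n), Array6.components (F.b₂ n))}

end

/-! Upper bound. Split a skew pair of double indices into ε^{βγ} times a part symmetric in the Latin
indices, plus ε_{jk} times a part symmetric in the Greek ones. With both traces zero this forces the
torsion to vanish (`a_eq_zero`). Then d²ω_α^i = 0 reduces to the algebraic Bianchi identity b² ∧ ω −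
b¹ ∧ ω = 0 (`bianchi`), while the traces of the equations for dω_α^β and dω_j^i show that b¹ and b²
are trace-free. Trace-free skew arrays have 18 + 18 parameters; Bianchi gives 16 equations and the
normalization 10. What remains is a pair of binary quartics, one on each index type
(`eq_weyl_of_bianchi`): the self-dual and anti-self-dual halves of a Weyl tensor. The listed
relations express the total symmetry of the quartics.

Lower bound. For each linear form, a plane wave on ℝ⁴ has the fourth power of that form as one
quartic and zero as the other (`latin_planeWave_mem`, `greek_planeWave_mem`). Fourth powers span the
quartics, so the span has dimension 5 + 5. -/

noncomputable section

/-! ### Exterior derivatives of 1-forms on a vector space -/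

section VectorSpace

variable {E : Type*} [NormedAddCommGroup E] [NormedSpace ℝ E]

/-- A field of covectors on a vector space as a differential form of degree one. -/
def toAlternating (Θ : E → E →L[ℝ] ℝ) (y : E) : E [⋀^Fin 1]→L[ℝ] ℝ :=
  ContinuousAlternatingMap.ofSubsingleton ℝ E ℝ (0 : Fin 1) (Θ y)

theorem differentiableAt_toAlternating {Θ : E → E →L[ℝ] ℝ} {y : E}
    (h : DifferentiableAt ℝ Θ y) : DifferentiableAt ℝ (toAlternating Θ) y :=
  ((ContinuousAlternatingMap.ofSubsingletonLIE (𝕜 := ℝ) (E := E) (F := ℝ)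
    (0 : Fin 1)).differentiable _).comp y h

theorem extDeriv_toAlternating_apply {Θ : E → E →L[ℝ] ℝ} {y : E}
    (h : DifferentiableAt ℝ Θ y) (u v : E) :
    extDeriv (toAlternating Θ) y ![u, v] = fderiv ℝ Θ y u v - fderiv ℝ Θ y v u := by
  have key (w t : E) : fderiv ℝ (fun z => Θ z w) y t = fderiv ℝ Θ y t w := by
    rw [fderiv_clm_apply h (differentiableAt_const w)]
    simp
  rw [extDeriv_apply (differentiableAt_toAlternating h)]
  simp [Fin.sum_univ_two, toAlternating, key, Fin.removeNth, sub_eq_add_neg]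

/-- This is d²Θ = 0: the six second derivatives cancel in pairs by symmetry. -/
theorem fderiv_cyclic_extDeriv {Θ : E → E →L[ℝ] ℝ} {y : E} (h : ContDiffAt ℝ 2 Θ y)
    (u v t : E) :
    fderiv ℝ (fun z => fderiv ℝ Θ z u v - fderiv ℝ Θ z v u) y t +
      fderiv ℝ (fun z => fderiv ℝ Θ z v t - fderiv ℝ Θ z t v) y u +
      fderiv ℝ (fun z => fderiv ℝ Θ z t u - fderiv ℝ Θ z u t) y v = 0 := by
  have hd : DifferentiableAt ℝ (fderiv ℝ Θ) y :=
    (h.fderiv_right (m := 1) (by norm_num)).differentiableAt one_ne_zero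
  have hs := h.isSymmSndFDerivAt (by simp)
  have hd1 (a : E) : DifferentiableAt ℝ (fun z => fderiv ℝ Θ z a) y :=
    hd.clm_apply (differentiableAt_const a)
  have hd2 (a b : E) : DifferentiableAt ℝ (fun z => fderiv ℝ Θ z a b) y :=
    (hd1 a).clm_apply (differentiableAt_const b)
  have key (a b c : E) : fderiv ℝ (fun z => fderiv ℝ Θ z a b) y c
      = fderiv ℝ (fderiv ℝ Θ) y c a b := by
    rw [fderiv_clm_apply (hd1 a) (differentiableAt_const b),
      fderiv_clm_apply hd (differentiableAt_const a)]
    simp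
  have key2 (a b c : E) : fderiv ℝ (fun z => fderiv ℝ Θ z a b - fderiv ℝ Θ z b a) y c
      = fderiv ℝ (fderiv ℝ Θ) y c a b - fderiv ℝ (fderiv ℝ Θ) y c b a := by
    rw [fderiv_fun_sub (hd2 a b) (hd2 b a)]
    simp [key]
  rw [key2, key2, key2, hs t u, hs t v, hs u v]
  ring

/-- The value on `u, v, t` of the exterior product of a 2-form and a 1-form. -/
def wedgeTwoOne (σ : E → E → ℝ) (η : E → ℝ) (u v t : E) : ℝ :=
  σ u v * η t + σ v t * η u + σ t u * η v

/-- Combines d²Θ = 0 with the Leibniz rule d(f ∧ g) = df ∧ g − f ∧ dg. The formula for dΘ is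
differentiated, so it has to hold near `y`. -/
theorem cyclic_extDeriv_sum_wedge {ι : Type*} [Fintype ι] {Θ : E → E →L[ℝ] ℝ}
    {f g : ι → E → E →L[ℝ] ℝ} {y : E} (hΘ : ContDiffAt ℝ 2 Θ y)
    (hf : ∀ i, DifferentiableAt ℝ (f i) y) (hg : ∀ i, DifferentiableAt ℝ (g i) y)
    (h : ∀ u v, ∀ᶠ z in 𝓝 y, fderiv ℝ Θ z u v - fderiv ℝ Θ z v u
      = ∑ i, (f i z u * g i z v - f i z v * g i z u)) (u v t : E) :
    ∑ i, (wedgeTwoOne (fun u v => fderiv ℝ (f i) y u v - fderiv ℝ (f i) y v u) (g i y) u v t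
      - wedgeTwoOne (fun u v => fderiv ℝ (g i) y u v - fderiv ℝ (g i) y v u) (f i y) u v t)
      = 0 := by
  have hev {θ : E → E →L[ℝ] ℝ} (hθ : DifferentiableAt ℝ θ y) (a : E) :
      DifferentiableAt ℝ (fun z => θ z a) y := hθ.clm_apply (differentiableAt_const a)
  have hval {θ : E → E →L[ℝ] ℝ} (hθ : DifferentiableAt ℝ θ y) (a c : E) :
      fderiv ℝ (fun z => θ z a) y c = fderiv ℝ θ y c a := by
    rw [fderiv_clm_apply hθ (differentiableAt_const a)]
    simp
  have key (a b c : E) : fderiv ℝ (fun z => fderiv ℝ Θ z a b - fderiv ℝ Θ z b a) y c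
      = ∑ i, (f i y a * fderiv ℝ (g i) y c b + g i y b * fderiv ℝ (f i) y c a
        - (f i y b * fderiv ℝ (g i) y c a + g i y a * fderiv ℝ (f i) y c b)) := by
    have hdiff (i : ι) : DifferentiableAt ℝ
        (fun z => f i z a * g i z b - f i z b * g i z a) y :=
      ((hev (hf i) a).mul (hev (hg i) b)).sub ((hev (hf i) b).mul (hev (hg i) a))
    rw [Filter.EventuallyEq.fderiv_eq (h a b), fderiv_fun_sum (fun i _ => hdiff i)]
    simp only [sum_apply]
    refine Finset.sum_congr rfl fun i _ => ?_
    rw [fderiv_fun_sub ((hev (hf i) a).fun_mul (hev (hg i) b))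
        ((hev (hf i) b).fun_mul (hev (hg i) a)),
      fderiv_fun_mul (hev (hf i) a) (hev (hg i) b), fderiv_fun_mul (hev (hf i) b) (hev (hg i) a)]
    simp [hval (hf i), hval (hg i)]
  have h0 := fderiv_cyclic_extDeriv hΘ u v t
  rw [key, key, key, ← Finset.sum_add_distrib, ← Finset.sum_add_distrib] at h0
  rw [← h0]
  refine Finset.sum_congr rfl fun i _ => ?_
  simp only [wedgeTwoOne]
  ring

end VectorSpace

/-! ### Exterior derivatives on a manifold: independence of the chart, and d² = 0 -/

namespace OneForm

variable {m : ℕ} {N : Type*} [TopologicalSpace N] [ChartedSpace (EuclideanSpace ℝ (Fin m)) N]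

local notation "𝔼" => EuclideanSpace ℝ (Fin m)

theorem Smooth.contDiffAt_inChart {θ : OneForm m N} (h : θ.Smooth) (x₀ : N) {y : 𝔼}
    (hy : y ∈ (extChartAt (𝓡 m) x₀).target) : ContDiffAt ℝ ∞ (θ.inChart x₀) y := by
  have h1 := h x₀
  rw [Set.preimage_univ, Set.inter_univ] at h1
  exact h1.contDiffAt ((isOpen_extChartAt_target x₀).mem_nhds hy)

theorem Smooth.differentiableAt_inChart {θ : OneForm m N} (h : θ.Smooth) (x₀ : N) {y : 𝔼}
    (hy : y ∈ (extChartAt (𝓡 m) x₀).target) : DifferentiableAt ℝ (θ.inChart x₀) y :=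
  (h.contDiffAt_inChart x₀ hy).differentiableAt (by simp)

theorem extD_eq_fderiv {θ : OneForm m N} (h : θ.Smooth) (x : N) (u v : TangentSpace (𝓡 m) x) :
    θ.extD x u v = fderiv ℝ (θ.inChart x) (extChartAt (𝓡 m) x x) (u : 𝔼) (v : 𝔼)
      - fderiv ℝ (θ.inChart x) (extChartAt (𝓡 m) x x) (v : 𝔼) (u : 𝔼) :=
  extDeriv_toAlternating_apply (h.differentiableAt_inChart x (mem_extChartAt_target x)) _ _

variable [IsManifold (𝓡 m) ∞ N]

theorem mdifferentiableAt_extChartAt_symm (x₀ : N) {y : 𝔼}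
    (hy : y ∈ (extChartAt (𝓡 m) x₀).target) :
    MDifferentiableAt 𝓘(ℝ, 𝔼) (𝓡 m) (extChartAt (𝓡 m) x₀).symm y := by
  have : IsManifold (𝓡 m) 1 N := .of_le (n := ∞) (by simp)
  have h := mdifferentiableWithinAt_extChartAt_symm hy
  rwa [ModelWithCorners.range_eq_univ, mdifferentiableWithinAt_univ] at h

/-- A tangent space is identified with the model space by the preferred chart at its own base point,
so the derivative of an inverse chart is that of a transition map. -/
theorem mfderiv_extChartAt_symm_eq_fderiv (x₀ : N) {y : 𝔼}
    (hy : y ∈ (extChartAt (𝓡 m) x₀).target) :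
    (mfderiv 𝓘(ℝ, 𝔼) (𝓡 m) (extChartAt (𝓡 m) x₀).symm y : 𝔼 →L[ℝ] 𝔼)
      = fderiv ℝ (extChartAt (𝓡 m) ((extChartAt (𝓡 m) x₀).symm y) ∘
        (extChartAt (𝓡 m) x₀).symm) y := by
  have h : (mfderiv 𝓘(ℝ, 𝔼) (𝓡 m) (extChartAt (𝓡 m) x₀).symm y : 𝔼 →L[ℝ] 𝔼)
      = fderivWithin ℝ (writtenInExtChartAt 𝓘(ℝ, 𝔼) (𝓡 m) y (extChartAt (𝓡 m) x₀).symm)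
        (Set.range 𝓘(ℝ, 𝔼)) (extChartAt 𝓘(ℝ, 𝔼) y y) :=
    if_pos (mdifferentiableAt_extChartAt_symm x₀ hy)
  rw [h, ModelWithCorners.range_eq_univ, fderivWithin_univ]
  rfl

theorem mfderiv_extChartAt_symm_self (x : N) :
    (mfderiv 𝓘(ℝ, 𝔼) (𝓡 m) (extChartAt (𝓡 m) x).symm (extChartAt (𝓡 m) x x) : 𝔼 →L[ℝ] 𝔼)
      = ContinuousLinearMap.id ℝ 𝔼 := by
  rw [mfderiv_extChartAt_symm_eq_fderiv x (mem_extChartAt_target x), extChartAt_to_inv]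
  rw [Filter.EventuallyEq.fderiv_eq (f := id), fderiv_id]
  filter_upwards [(isOpen_extChartAt_target (I := 𝓡 m) x).mem_nhds (mem_extChartAt_target x)]
    with z hz using (extChartAt (𝓡 m) x).right_inv hz

theorem inChart_self (θ : OneForm m N) (x : N) (u : TangentSpace (𝓡 m) x) :
    θ.inChart x (extChartAt (𝓡 m) x x) (u : 𝔼) = θ x u := by
  have h := mfderiv_extChartAt_symm_self (m := m) x
  have h2 : θ.inChart x (extChartAt (𝓡 m) x x) (u : 𝔼)
      = (θ ((extChartAt (𝓡 m) x).symm (extChartAt (𝓡 m) x x)) : 𝔼 →L[ℝ] ℝ)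
        ((mfderiv 𝓘(ℝ, 𝔼) (𝓡 m) (extChartAt (𝓡 m) x).symm (extChartAt (𝓡 m) x x) :
          𝔼 →L[ℝ] 𝔼) (u : 𝔼)) := rfl
  rw [h2, h]
  have h3 (z : N) (hz : z = x) : (θ z : 𝔼 →L[ℝ] ℝ) (u : 𝔼) = θ x u := by subst hz; rfl
  exact h3 _ (extChartAt_to_inv x)

omit [IsManifold (𝓡 m) ∞ N] in
theorem inChart_apply (θ : OneForm m N) (x₀ : N) (y u : 𝔼) :
    θ.inChart x₀ y u = θ ((extChartAt (𝓡 m) x₀).symm y)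
      (mfderiv 𝓘(ℝ, 𝔼) (𝓡 m) (extChartAt (𝓡 m) x₀).symm y u) := rfl

/-- Two chart expressions of a form differ by pullback along the transition map. `extD` uses a
different chart at each point, and this relation allows all of them to be compared with one fixed
chart. -/
theorem inChart_eventuallyEq (θ : OneForm m N) (x₀ : N) {y : 𝔼}
    (hy : y ∈ (extChartAt (𝓡 m) x₀).target) :
    θ.inChart x₀ =ᶠ[𝓝 y] fun z =>
      (θ.inChart ((extChartAt (𝓡 m) x₀).symm y)
        ((extChartAt (𝓡 m) ((extChartAt (𝓡 m) x₀).symm y) ∘ (extChartAt (𝓡 m) x₀).symm) z)).comp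
      (fderiv ℝ (extChartAt (𝓡 m) ((extChartAt (𝓡 m) x₀).symm y) ∘
        (extChartAt (𝓡 m) x₀).symm) z) := by
  set φ₀ := extChartAt (𝓡 m) x₀ with hφ₀
  set n := φ₀.symm y with hn
  set φ := extChartAt (𝓡 m) n with hφ
  have : IsManifold (𝓡 m) 1 N := .of_le (n := ∞) (by simp)
  have hcont : ContinuousAt φ₀.symm y := continuousAt_extChartAt_symm'' hy
  have hev : ∀ᶠ z in 𝓝 y, z ∈ φ₀.target ∧ φ₀.symm z ∈ φ.source :=
    Filter.Eventually.and ((isOpen_extChartAt_target (I := 𝓡 m) x₀).mem_nhds hy)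
      (hcont.preimage_mem_nhds (extChartAt_source_mem_nhds n))
  filter_upwards [hev.eventually_nhds] with z hz
  obtain ⟨hz1, hz2⟩ := hz.self_of_nhds
  have hψ : MDifferentiableAt 𝓘(ℝ, 𝔼) 𝓘(ℝ, 𝔼) (φ ∘ φ₀.symm) z :=
    (mdifferentiableAt_extChartAt (by simpa [hφ] using hz2)).comp z
      (mdifferentiableAt_extChartAt_symm x₀ hz1)
  have hz3 : (φ ∘ φ₀.symm) z ∈ φ.target := φ.map_source hz2
  have hchain := mfderiv_comp z (mdifferentiableAt_extChartAt_symm n hz3) hψ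
  have heq : φ.symm ∘ (φ ∘ φ₀.symm) =ᶠ[𝓝 z] φ₀.symm := by
    filter_upwards [hz] with w hw using φ.left_inv hw.2
  have hpt : φ.symm ((φ ∘ φ₀.symm) z) = φ₀.symm z := φ.left_inv hz2
  have h1 : (mfderiv 𝓘(ℝ, 𝔼) (𝓡 m) φ₀.symm z : 𝔼 →L[ℝ] 𝔼) =
      (mfderiv 𝓘(ℝ, 𝔼) (𝓡 m) φ.symm ((φ ∘ φ₀.symm) z) : 𝔼 →L[ℝ] 𝔼).comp
        (fderiv ℝ (φ ∘ φ₀.symm) z) := by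
    have h2 : (mfderiv 𝓘(ℝ, 𝔼) (𝓡 m) (φ.symm ∘ (φ ∘ φ₀.symm)) z : 𝔼 →L[ℝ] 𝔼)
        = mfderiv 𝓘(ℝ, 𝔼) (𝓡 m) φ₀.symm z := heq.mfderiv_eq
    have h3 : (mfderiv 𝓘(ℝ, 𝔼) 𝓘(ℝ, 𝔼) (φ ∘ φ₀.symm) z : 𝔼 →L[ℝ] 𝔼)
        = fderiv ℝ (φ ∘ φ₀.symm) z := mfderiv_eq_fderiv
    exact h2.symm.trans (hchain.trans (congrArg
      (mfderiv 𝓘(ℝ, 𝔼) (𝓡 m) φ.symm ((φ ∘ φ₀.symm) z) : 𝔼 →L[ℝ] 𝔼).comp h3))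
  have h4 : ∀ p q : N, p = q → (θ p : 𝔼 →L[ℝ] ℝ) = (θ q : 𝔼 →L[ℝ] ℝ) := by
    rintro p q rfl; rfl
  change ((θ (φ₀.symm z) : 𝔼 →L[ℝ] ℝ)).comp
    (mfderiv 𝓘(ℝ, 𝔼) (𝓡 m) φ₀.symm z : 𝔼 →L[ℝ] 𝔼) =
    (((θ (φ.symm ((φ ∘ φ₀.symm) z)) : 𝔼 →L[ℝ] ℝ)).comp
    (mfderiv 𝓘(ℝ, 𝔼) (𝓡 m) φ.symm ((φ ∘ φ₀.symm) z) : 𝔼 →L[ℝ] 𝔼)).comp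
      (fderiv ℝ (φ ∘ φ₀.symm) z)
  rw [h1, h4 _ _ hpt]
  rfl

/-- The exterior derivative may be computed in any preferred chart. -/
theorem extD_mfderiv {θ : OneForm m N} (h : θ.Smooth) (x₀ : N) {y : 𝔼}
    (hy : y ∈ (extChartAt (𝓡 m) x₀).target) (u v : 𝔼) :
    θ.extD ((extChartAt (𝓡 m) x₀).symm y)
        (mfderiv 𝓘(ℝ, 𝔼) (𝓡 m) (extChartAt (𝓡 m) x₀).symm y u)
        (mfderiv 𝓘(ℝ, 𝔼) (𝓡 m) (extChartAt (𝓡 m) x₀).symm y v)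
      = fderiv ℝ (θ.inChart x₀) y u v - fderiv ℝ (θ.inChart x₀) y v u := by
  rw [← extDeriv_toAlternating_apply (h.differentiableAt_inChart x₀ hy)]
  have hψ : ContDiffAt ℝ ∞ (extChartAt (𝓡 m) ((extChartAt (𝓡 m) x₀).symm y) ∘
        (extChartAt (𝓡 m) x₀).symm) y := by
    have := contDiffWithinAt_ext_coord_change (I := 𝓡 m) (n := ∞)
      ((extChartAt (𝓡 m) x₀).symm y) x₀ (y := y) (by simpa using hy)
    rwa [ModelWithCorners.range_eq_univ, contDiffWithinAt_univ] at this
  have hd : DifferentiableAt ℝ (toAlternating (θ.inChart ((extChartAt (𝓡 m) x₀).symm y)))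
      ((extChartAt (𝓡 m) ((extChartAt (𝓡 m) x₀).symm y) ∘ (extChartAt (𝓡 m) x₀).symm) y) :=
    differentiableAt_toAlternating (h.differentiableAt_inChart _ (mem_extChartAt_target _))
  have hpull := extDeriv_pullback hd (hψ.of_le (m := 2) (WithTop.coe_le_coe.2 (le_top : (2 : ℕ∞) ≤ ⊤))) (by simp)
  have hE : toAlternating (θ.inChart x₀) =ᶠ[𝓝 y] fun z =>
      (toAlternating (θ.inChart ((extChartAt (𝓡 m) x₀).symm y))
        ((extChartAt (𝓡 m) ((extChartAt (𝓡 m) x₀).symm y) ∘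
          (extChartAt (𝓡 m) x₀).symm) z)).compContinuousLinearMap
      (fderiv ℝ (extChartAt (𝓡 m) ((extChartAt (𝓡 m) x₀).symm y) ∘
        (extChartAt (𝓡 m) x₀).symm) z) := by
    filter_upwards [θ.inChart_eventuallyEq x₀ hy] with z hz
    rw [toAlternating, hz]
    ext w
    rfl
  rw [hE.extDeriv_eq, hpull, ContinuousAlternatingMap.compContinuousLinearMap_apply,
    ← mfderiv_extChartAt_symm_eq_fderiv x₀ hy]
  unfold extD
  congr 1
  ext i
  fin_cases i <;> rfl

omit [IsManifold (𝓡 m) ∞ N] in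
theorem extD_neg {θ η : OneForm m N} (hθ : θ.Smooth) (hη : η.Smooth)
    (h : ∀ x v, θ x v + η x v = 0) (x : N) (u v : TangentSpace (𝓡 m) x) :
    θ.extD x u v + η.extD x u v = 0 := by
  have hη' : η.inChart x = fun y => - θ.inChart x y := by
    funext y
    ext w
    have := h _ (mfderiv 𝓘(ℝ, 𝔼) (𝓡 m) (extChartAt (𝓡 m) x).symm y w)
    rw [neg_apply, inChart_apply, inChart_apply]
    linarith
  rw [extD_eq_fderiv hθ, extD_eq_fderiv hη, hη', fderiv_fun_neg]
  have key (T : 𝔼 →L[ℝ] 𝔼 →L[ℝ] ℝ) (a b : 𝔼) : T a b - T b a + ((-T) a b - (-T) b a) = 0 := by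
    simp
  exact key _ u v

/-- The identity `d²θ = 0`, for a 1-form with `dθ = ∑ fᵢ ∧ gᵢ`. -/
theorem sum_extD_wedge_eq_zero {ι : Type*} [Fintype ι] {θ : OneForm m N} {f g : ι → OneForm m N}
    (hθ : θ.Smooth) (hf : ∀ i, (f i).Smooth) (hg : ∀ i, (g i).Smooth)
    (h : ∀ x u v, θ.extD x u v = ∑ i, wedge (f i) (g i) x u v)
    (x : N) (u v t : TangentSpace (𝓡 m) x) :
    ∑ i, ((f i).extD x u v * g i x t + (f i).extD x v t * g i x u + (f i).extD x t u * g i x v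
      - ((g i).extD x u v * f i x t + (g i).extD x v t * f i x u + (g i).extD x t u * f i x v))
      = 0 := by
  have hx := mem_extChartAt_target (I := 𝓡 m) x
  have key := cyclic_extDeriv_sum_wedge (Θ := θ.inChart x) (f := fun i => (f i).inChart x)
    (g := fun i => (g i).inChart x) (y := extChartAt (𝓡 m) x x)
    ((hθ.contDiffAt_inChart x hx).of_le (WithTop.coe_le_coe.2 (le_top : (2 : ℕ∞) ≤ ⊤)))
    (fun i => (hf i).differentiableAt_inChart x hx) (fun i => (hg i).differentiableAt_inChart x hx)
    -- The hypothesis at a nearby point refers to the chart there; `extD_mfderiv` carries it to the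
    -- chart at `x`.
    (fun a b => by
      filter_upwards [(isOpen_extChartAt_target (I := 𝓡 m) x).mem_nhds hx] with z hz
      rw [← extD_mfderiv hθ x hz, h]
      rfl) u v t
  rw [← key]
  refine Finset.sum_congr rfl fun i _ => ?_
  simp only [wedgeTwoOne, extD_eq_fderiv (hf i), extD_eq_fderiv (hg i), inChart_self]

end OneForm

/-! ### Vanishing torsion, trace-free curvature and the first Bianchi identity -/

@[simp] theorem kron_self (a : Fin 2) : kron a a = 1 := if_pos rfl

@[simp] theorem kron_zero_one : kron 0 1 = 0 := if_neg (by decide)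

@[simp] theorem kron_one_zero : kron 1 0 = 0 := if_neg (by decide)

theorem sum_kron_mul (f : Fin 2 → ℝ) (a : Fin 2) : ∑ x, kron a x * f x = f a := by
  simp [kron]

/-- A skew-symmetric torsion array both of whose traces vanish is zero. -/
theorem Array6.eq_zero_of_skew_of_traces {a : Array6}
    (skew : ∀ α j k i β γ, a α j k i β γ = - a α k j i γ β)
    (trace₁ : ∀ j k i γ, ∑ α, a α j k i α γ = 0)
    (trace₂ : ∀ α k β γ, ∑ i, a α i k i β γ = 0) (α j k i β γ : Fin 2) :
    a α j k i β γ = 0 := by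
  -- In a = ε^{βγ} s_{αjk}^i + ε_{jk} r_α^{iβγ}, with s symmetric in j, k and r in β, γ, the part of
  -- `trace₁` symmetric in j, k gives s = 0; likewise `trace₂` gives r = 0.
  simp only [Fin.sum_univ_two] at trace₁ trace₂
  revert α j k i β γ
  simp only [Fin.forall_fin_two] at *
  refine ⟨?_, ?_⟩ <;> grind

namespace AGStructureForms

variable {M : Type*} [TopologicalSpace M] [ChartedSpace (EuclideanSpace ℝ (Fin 4)) M]
  {S : AlmostGrassmann13 M} {m : ℕ} {N : Type*} [TopologicalSpace N]
  [ChartedSpace (EuclideanSpace ℝ (Fin m)) N] (F : AGStructureForms S m N)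

theorem a_eq_zero (n : N) (α j k i β γ : Fin 2) : F.a n α j k i β γ = 0 :=
  Array6.eq_zero_of_skew_of_traces (F.a_skew n) (F.a_trace₁ n) (F.a_trace₂ n) α j k i β γ

theorem exists_dual (n : N) : ∃ e : Fin 2 → Fin 2 → TangentSpace (𝓡 m) n,
    ∀ α i γ k, F.w α i n (e γ k) = kron γ α * kron k i := by
  have h (c : Coords) : ∃ v, ∀ α i, F.w α i n v = c α i := by
    obtain ⟨v, hv⟩ := F.submersion n ((F.frame n).symm c)
    exact ⟨v, fun α i => by rw [F.w_apply, hv, LinearEquiv.apply_symm_apply]⟩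
  choose e he using fun γ k : Fin 2 => h fun α i => kron γ α * kron k i
  exact ⟨e, fun α i γ k => he γ k α i⟩

open OneForm

/-- The 2-form `b_{kl}^{γδ} ω_γ^k ∧ ω_δ^l`. -/
def curvatureForm (b : Fin 2 → Fin 2 → Fin 2 → Fin 2 → ℝ) (n : N)
    (u v : TangentSpace (𝓡 m) n) : ℝ :=
  ∑ k, ∑ l, ∑ γ, ∑ δ, b k l γ δ * wedge (F.w γ k) (F.w δ l) n u v

/-- Vectors dual to the basis forms isolate one coefficient. It appears twice because the sum runs
over both orders of each pair of double indices. -/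
theorem curvatureForm_dual {b : Fin 2 → Fin 2 → Fin 2 → Fin 2 → ℝ}
    (hb : ∀ k l γ δ, b k l γ δ = - b l k δ γ) {n : N}
    {e : Fin 2 → Fin 2 → TangentSpace (𝓡 m) n}
    (he : ∀ α i γ k, F.w α i n (e γ k) = kron γ α * kron k i) (γ δ k l : Fin 2) :
    F.curvatureForm b n (e γ k) (e δ l) = 2 * b k l γ δ := by
  have h : ∀ k' l' γ' δ', b k' l' γ' δ' * wedge (F.w γ' k') (F.w δ' l') n (e γ k) (e δ l)
      = kron k k' * (kron l l' * (kron γ γ' * (kron δ δ' * b k' l' γ' δ')))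
        - kron l k' * (kron k l' * (kron δ γ' * (kron γ δ' * b k' l' γ' δ'))) := by
    intro k' l' γ' δ'
    simp only [wedge, he]
    ring
  simp only [curvatureForm, h, Finset.sum_sub_distrib, ← Finset.mul_sum, sum_kron_mul]
  rw [hb l k δ γ]
  ring

theorem extD_w (n : N) (u v : TangentSpace (𝓡 m) n) (α i : Fin 2) :
    (F.w α i).extD n u v = ∑ j, wedge (F.w α j) (F.B j i) n u v
      + ∑ β, wedge (F.A α β) (F.w β i) n u v + wedge F.o (F.w α i) n u v := by
  have h := F.d_w n u v α i
  simp only [a_eq_zero, zero_mul, Finset.sum_const_zero] at h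
  linarith

theorem extD_A (n : N) (u v : TangentSpace (𝓡 m) n) (α β : Fin 2) :
    (F.A α β).extD n u v = ∑ γ, wedge (F.A α γ) (F.A γ β) n u v
      + ((1 / 2) * (kron α β * (∑ γ, ∑ k, wedge (F.w γ k) (F.z k γ) n u v)
        - 2 * ∑ k, wedge (F.w α k) (F.z k β) n u v)
        + F.curvatureForm (fun k l γ δ => F.b₂ n α k l β γ δ) n u v) := by
  have h := F.d_A n u v α β
  rw [curvatureForm]
  linarith

theorem extD_B (n : N) (u v : TangentSpace (𝓡 m) n) (j i : Fin 2) :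
    (F.B j i).extD n u v = ∑ k, wedge (F.B j k) (F.B k i) n u v
      + ((1 / 2) * (kron j i * (∑ k, ∑ γ, wedge (F.z k γ) (F.w γ k) n u v)
        - 2 * ∑ γ, wedge (F.z j γ) (F.w γ i) n u v)
        + F.curvatureForm (fun k l γ δ => F.b₁ n j k l i γ δ) n u v) := by
  have h := F.d_B n u v j i
  rw [curvatureForm]
  linarith

/-- The trace of dω_α^β vanishes with that of ω_α^β. On the right the quadratic terms cancel by
antisymmetry, and the terms in ω_i^α cancel because the trace of δ_α^β is 2; only the curvature is
left. -/
theorem b₂_trace (n : N) (k l γ δ : Fin 2) : ∑ α, F.b₂ n α k l α γ δ = 0 := by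
  obtain ⟨e, he⟩ := F.exists_dual n
  have h0 (x : N) (v : TangentSpace (𝓡 m) x) : F.A 0 0 x v + F.A 1 1 x v = 0 := by
    rw [← F.trace_A x v, Fin.sum_univ_two]
  have h := extD_neg (F.smooth_A 0 0) (F.smooth_A 1 1) h0 n (e γ k) (e δ l)
  rw [extD_A, extD_A, F.curvatureForm_dual (fun _ _ _ _ => F.b₂_skew _ _ _ _ _ _ _) he,
    F.curvatureForm_dual (fun _ _ _ _ => F.b₂_skew _ _ _ _ _ _ _) he] at h
  simp only [Fin.sum_univ_two, wedge, kron_self] at h ⊢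
  linarith

theorem b₁_trace (n : N) (k l γ δ : Fin 2) : ∑ i, F.b₁ n i k l i γ δ = 0 := by
  obtain ⟨e, he⟩ := F.exists_dual n
  have h0 (x : N) (v : TangentSpace (𝓡 m) x) : F.B 0 0 x v + F.B 1 1 x v = 0 := by
    rw [← F.trace_B x v, Fin.sum_univ_two]
  have h := extD_neg (F.smooth_B 0 0) (F.smooth_B 1 1) h0 n (e γ k) (e δ l)
  rw [extD_B, extD_B, F.curvatureForm_dual (fun _ _ _ _ => F.b₁_skew _ _ _ _ _ _ _) he,
    F.curvatureForm_dual (fun _ _ _ _ => F.b₁_skew _ _ _ _ _ _ _) he] at h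
  simp only [Fin.sum_univ_two, wedge, kron_self] at h ⊢
  linarith

set_option maxHeartbeats 4000000 in
/-- The first Bianchi identity, as an identity of 3-forms. -/
theorem bianchi_form [IsManifold (𝓡 m) ∞ N] (n : N) (u v t : TangentSpace (𝓡 m) n)
    (α i : Fin 2) :
    let β₁ := fun j => F.curvatureForm (fun k l γ δ => F.b₁ n j k l i γ δ) n
    let β₂ := fun β => F.curvatureForm (fun k l γ δ => F.b₂ n α k l β γ δ) n
    ∑ β, (β₂ β u v * F.w β i n t + β₂ β v t * F.w β i n u + β₂ β t u * F.w β i n v)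
      - ∑ j, (β₁ j u v * F.w α j n t + β₁ j v t * F.w α j n u + β₁ j t u * F.w α j n v)
      = 0 := by
  intro β₁ β₂
  -- The three summands of the index type are the terms ω_α^j ∧ ω_j^i, ω_α^β ∧ ω_β^i and ω ∧ ω_α^i
  -- of dω_α^i.
  have key := sum_extD_wedge_eq_zero (ι := Fin 2 ⊕ Fin 2 ⊕ Unit) (θ := F.w α i)
    (f := Sum.elim (F.w α) (Sum.elim (F.A α) fun _ => F.o))
    (g := Sum.elim (F.B · i) (Sum.elim (F.w · i) fun _ => F.w α i))
    (F.smooth_w α i)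
    (by rintro (j | β | _); exacts [F.smooth_w α j, F.smooth_A α β, F.smooth_o])
    (by rintro (j | β | _); exacts [F.smooth_B j i, F.smooth_w β i, F.smooth_w α i])
    (by
      intro x u v
      rw [F.extD_w]
      simp only [Fintype.sum_sum_type, Sum.elim_inl, Sum.elim_inr, Finset.univ_unique,
        Finset.sum_singleton]
      ring) n u v t
  simp only [Fintype.sum_sum_type, Sum.elim_inl, Sum.elim_inr, Finset.univ_unique,
    Finset.sum_singleton, extD_w, extD_A, extD_B, F.d_o] at key
  simp only [show ∀ j, F.curvatureForm (fun k l γ δ => F.b₁ n j k l i γ δ) n = β₁ j from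
    fun _ => rfl, show ∀ β, F.curvatureForm (fun k l γ δ => F.b₂ n α k l β γ δ) n = β₂ β from
    fun _ => rfl] at key
  -- With the curvature forms opaque, the remaining identity is polynomial: all terms in the
  -- connection forms and in ω_i^α cancel.
  clear_value β₁ β₂
  simp only [wedge, Fin.sum_univ_two] at key ⊢
  obtain rfl | rfl : α = 0 ∨ α = 1 := by omega
  all_goals
    obtain rfl | rfl : i = 0 ∨ i = 1 := by omega
    all_goals
      simp only [kron_self, kron_zero_one, kron_one_zero] at key
      linear_combination key

/-- Evaluates the 3-form identity on three dual vectors; the common factor 2 from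
`curvatureForm_dual` is divided out. -/
theorem bianchi [IsManifold (𝓡 m) ∞ N] (n : N) (α i γ δ ε k l p : Fin 2) :
    (F.b₂ n α k l ε γ δ * kron p i + F.b₂ n α l p γ δ ε * kron k i
        + F.b₂ n α p k δ ε γ * kron l i)
      - (F.b₁ n p k l i γ δ * kron ε α + F.b₁ n k l p i δ ε * kron γ α
        + F.b₁ n l p k i ε γ * kron δ α) = 0 := by
  obtain ⟨e, he⟩ := F.exists_dual n
  have h := F.bianchi_form n (e γ k) (e δ l) (e ε p) α i
  simp only [F.curvatureForm_dual (fun _ _ _ _ => F.b₁_skew _ _ _ _ _ _ _) he,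
    F.curvatureForm_dual (fun _ _ _ _ => F.b₂_skew _ _ _ _ _ _ _) he, he,
    Finset.sum_add_distrib] at h
  have h1 (c : ℝ) (f : Fin 2 → ℝ) (a : Fin 2) : ∑ x, 2 * f x * (kron a x * c) = 2 * (f a * c) := by
    rw [← sum_kron_mul (fun x => 2 * (f x * c)) a]
    exact Finset.sum_congr rfl fun x _ => by ring
  have h2 (c : ℝ) (f : Fin 2 → ℝ) (a : Fin 2) : ∑ x, 2 * f x * (c * kron a x) = 2 * (f a * c) := by
    rw [← h1]
    exact Finset.sum_congr rfl fun x _ => by ring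
  simp only [h1, h2] at h
  linarith

end AGStructureForms

/-! ### Algebraic solution of the Bianchi identity by binary quartics -/

/-- The skew-symmetric tensor `ε` on two indices, with `ε 0 1 = 1`. -/
def eps (a b : Fin 2) : ℝ := kron a 0 * kron b 1 - kron a 1 * kron b 0

/-- The entry of the binary quartic form with coefficients `ψ` at four indices. -/
def quartic (ψ : Fin 5 → ℝ) (a b c d : Fin 2) : ℝ :=
  -- The sum is taken in ℕ: it counts the indices equal to 1.
  ψ ⟨a + b + c + d, by omega⟩

/-- The array `b_{jkl}^{iγδ} = ε^{γδ} ψ_{jklp} ε^{ip}` of a binary quartic form `ψ`. -/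
def latinWeyl (ψ : Fin 5 → ℝ) : Array6 := fun j k l i γ δ =>
  -- Modulo 2, `i + 1` is the index other than `i`, the only one contributing to the sum over p.
  eps γ δ * (eps i (i + 1) * quartic ψ j k l (i + 1))

/-- The array `b_{αkl}^{βγδ} = ε_{kl} ψ^{πβγδ} ε_{απ}` of a binary quartic form `ψ`. -/
def greekWeyl (ψ : Fin 5 → ℝ) : Array6 := fun α k l β γ δ =>
  eps k l * (eps α (α + 1) * quartic ψ β γ δ (α + 1))

@[simp] theorem eps_self (a : Fin 2) : eps a a = 0 := by simp [eps, mul_comm]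

@[simp] theorem eps_zero_one : eps 0 1 = 1 := by simp [eps]

@[simp] theorem eps_one_zero : eps 1 0 = -1 := by simp [eps]

@[simp] theorem Fin.one_add_one_of_two : (1 + 1 : Fin 2) = 0 := rfl

/-- A curvature array satisfying the first Bianchi identity and the normalization is given by a
pair of binary quartic forms, one on each index type. -/
theorem eq_weyl_of_bianchi {b₁ b₂ : Array6}
    (skew₁ : ∀ j k l i γ δ, b₁ j k l i γ δ = - b₁ j l k i δ γ)
    (skew₂ : ∀ α k l β γ δ, b₂ α k l β γ δ = - b₂ α l k β δ γ)
    (trace₁ : ∀ k l γ δ, ∑ i, b₁ i k l i γ δ = 0)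
    (trace₂ : ∀ k l γ δ, ∑ α, b₂ α k l α γ δ = 0)
    (normal : ∀ k l γ δ, (∑ α, b₂ α k l γ α δ) - (∑ i, b₁ k i l i γ δ)
      + (∑ α, b₂ α l k δ α γ) - (∑ i, b₁ l i k i δ γ) = 0)
    (bianchi : ∀ α i γ δ ε k l p,
      (b₂ α k l ε γ δ * kron p i + b₂ α l p γ δ ε * kron k i + b₂ α p k δ ε γ * kron l i)
      - (b₁ p k l i γ δ * kron ε α + b₁ k l p i δ ε * kron γ α + b₁ l p k i ε γ * kron δ α) = 0) :
    b₁ = latinWeyl ![b₁ 0 0 0 1 1 0, b₁ 0 0 0 0 0 1, b₁ 0 0 1 0 0 1, b₁ 0 1 1 0 0 1,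
      b₁ 1 1 1 0 0 1] ∧
    b₂ = greekWeyl ![b₂ 1 1 0 0 0 0, b₂ 0 0 1 0 0 0, b₂ 0 0 1 0 0 1, b₂ 0 0 1 0 1 1,
      b₂ 0 0 1 1 1 1] := by
  -- A 3-form in four variables has four coefficients, one for each triple of distinct basis forms,
  -- so these four instances suffice.
  have h1 := fun α i => bianchi α i 0 0 1 0 1 0
  have h2 := fun α i => bianchi α i 0 0 1 0 1 1
  have h3 := fun α i => bianchi α i 0 1 1 0 0 1
  have h4 := fun α i => bianchi α i 0 1 1 1 0 1
  clear bianchi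
  simp only [Fin.sum_univ_two] at trace₁ trace₂ normal
  simp only [Fin.forall_fin_two, kron_self, kron_zero_one, kron_one_zero, mul_zero, mul_one,
    add_zero, zero_add] at *
  constructor
  all_goals
    funext i₁ i₂ i₃ i₄ i₅ i₆
    revert i₁ i₂ i₃ i₄ i₅ i₆
    simp only [Fin.forall_fin_two, latinWeyl, greekWeyl, eps_self, eps_zero_one, eps_one_zero,
      zero_add, Fin.one_add_one_of_two, zero_mul, one_mul, neg_mul, neg_neg]
    simp [quartic]
  · refine ⟨⟨⟨⟨?_, ?_⟩, ?_, ?_⟩, ?_, ?_⟩, ⟨⟨?_, ?_⟩, ?_, ?_⟩, ?_, ?_⟩ <;> grind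
  · refine ⟨⟨⟨?_, ?_⟩, ?_, ?_⟩, ⟨?_, ?_⟩, ?_, ?_⟩ <;> grind

theorem AGStructureForms.eq_weyl {M : Type*} [TopologicalSpace M]
    [ChartedSpace (EuclideanSpace ℝ (Fin 4)) M] {S : AlmostGrassmann13 M} {m : ℕ} {N : Type*}
    [TopologicalSpace N] [ChartedSpace (EuclideanSpace ℝ (Fin m)) N] [IsManifold (𝓡 m) ∞ N]
    (F : AGStructureForms S m N) (n : N) :
    ∃ ψ φ, F.b₁ n = latinWeyl ψ ∧ F.b₂ n = greekWeyl φ :=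
  ⟨_, _, eq_weyl_of_bianchi (F.b₁_skew n) (F.b₂_skew n) (F.b₁_trace n) (F.b₂_trace n)
    (F.b_normal n) (F.bianchi n)⟩

/-! ### Structures on `ℝ⁴` -/

local notation "𝔼" => EuclideanSpace ℝ (Fin 4)

theorem inChart_modelSpace (θ : OneForm 4 𝔼) (x : 𝔼) : θ.inChart x = θ := by
  funext y
  have h : (mfderiv 𝓘(ℝ, 𝔼) (𝓡 4) (extChartAt (𝓡 4) x).symm y : 𝔼 →L[ℝ] 𝔼)
      = ContinuousLinearMap.id ℝ 𝔼 := by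
    have h2 : ((extChartAt (𝓡 4) x).symm : 𝔼 → 𝔼) = id := by
      simp
      rfl
    have h3 := mfderiv_id (I := 𝓘(ℝ, 𝔼)) (x := y)
    rw [← h2] at h3
    exact h3
  ext u
  change (θ y : 𝔼 →L[ℝ] ℝ)
    ((mfderiv 𝓘(ℝ, 𝔼) (𝓡 4) (extChartAt (𝓡 4) x).symm y : 𝔼 →L[ℝ] 𝔼) u) = _
  rw [h]
  rfl

namespace OneForm

variable {m : ℕ} {N : Type*} [TopologicalSpace N] [ChartedSpace (EuclideanSpace ℝ (Fin m)) N]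

theorem zero_wedge (θ : OneForm m N) (n : N) (u v : TangentSpace (𝓡 m) n) :
    wedge 0 θ n u v = 0 := by simp [wedge]

theorem wedge_zero (θ : OneForm m N) (n : N) (u v : TangentSpace (𝓡 m) n) :
    wedge θ 0 n u v = 0 := by simp [wedge]

/-- The 1-form `a + f b` on `ℝ⁴`, where `a` and `b` have constant coefficients. -/
def affine (a b : 𝔼 →L[ℝ] ℝ) (f : 𝔼 → ℝ) : OneForm 4 𝔼 := fun n => (a + f n • b : 𝔼 →L[ℝ] ℝ)

/-- The 1-form on `ℝ⁴` with constant coefficients. -/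
def const (a : 𝔼 →L[ℝ] ℝ) : OneForm 4 𝔼 := fun _ => a

theorem affine_apply (a b : 𝔼 →L[ℝ] ℝ) (f : 𝔼 → ℝ) (n : 𝔼) (u : TangentSpace (𝓡 4) n) :
    affine a b f n u = const a n u + f n * const b n u := rfl

theorem const_sum_smul (s : Fin 2 → ℝ) (a : Fin 2 → 𝔼 →L[ℝ] ℝ) (n : 𝔼)
    (u : TangentSpace (𝓡 4) n) :
    const (∑ j, s j • a j) n u = s 0 * const (a 0) n u + s 1 * const (a 1) n u := by
  rw [Fin.sum_univ_two]
  rfl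

theorem const_zero_apply (n : 𝔼) (u : TangentSpace (𝓡 4) n) : const 0 n u = 0 := rfl

theorem smooth_affine (a b : 𝔼 →L[ℝ] ℝ) {f : 𝔼 → ℝ} (hf : ContDiff ℝ ∞ f) :
    (affine a b f).Smooth := by
  intro x
  rw [inChart_modelSpace]
  have h : ContDiff ℝ ∞ fun n => a + f n • b := by fun_prop
  exact h.contDiffOn

/-- Here d(a + f b) = df ∧ b. The differential of `f` is taken proportional to a fixed `p` because
plane wave coefficients depend on one linear function only. -/
theorem extD_affine (a b : 𝔼 →L[ℝ] ℝ) {f : 𝔼 → ℝ} (hf : ContDiff ℝ ∞ f) {n : 𝔼} {c : ℝ}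
    {p : 𝔼 →L[ℝ] ℝ} (hp : HasFDerivAt f (c • p) n) (u v : TangentSpace (𝓡 4) n) :
    (affine a b f).extD n u v
      = c * const p n u * const b n v - c * const p n v * const b n u := by
  rw [extD_eq_fderiv (smooth_affine a b hf), inChart_modelSpace]
  have h : HasFDerivAt (fun n => a + f n • b) ((c • p).smulRight b) n :=
    (hp.smul_const b).const_add a
  have h2 (u v : 𝔼) : fderiv ℝ (fun n => a + f n • b) n u v = c * p u * b v := by
    rw [h.fderiv]
    rfl
  exact congrArg₂ (· - ·) (h2 u v) (h2 v u)

theorem hasFDerivAt_linear (c : ℝ) (p : 𝔼 →L[ℝ] ℝ) (n : 𝔼) :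
    HasFDerivAt (fun n => c * p n) (c • p) n := p.hasFDerivAt.const_mul c

theorem hasFDerivAt_quadratic (c : ℝ) (p : 𝔼 →L[ℝ] ℝ) (n : 𝔼) :
    HasFDerivAt (fun n => c * p n ^ 2) ((2 * c * p n) • p) n := by
  have h := (p.hasFDerivAt (x := n).pow 2).const_mul c
  convert! h using 1
  rw [smul_smul]
  congr 1
  push_cast
  ring

theorem smooth_zero : (0 : OneForm 4 𝔼).Smooth := by
  have h : (0 : OneForm 4 𝔼) = affine 0 0 fun _ => 0 := by
    funext n
    ext u
    change 0 = (0 + (0 : ℝ) • 0 : ℝ)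
    simp
  rw [h]
  exact smooth_affine 0 0 contDiff_const

theorem extD_zero (n : 𝔼) (u v : TangentSpace (𝓡 4) n) : (0 : OneForm 4 𝔼).extD n u v = 0 := by
  have h := extD_neg smooth_zero smooth_zero (fun _ _ => by simp) n u v
  linarith

end OneForm

open OneForm in
/-- A smooth field of coframes on `ℝ⁴` with a torsion-free special linear connection whose
curvature satisfies the normalization defines an almost Grassmann structure with the same
curvature tensor. -/
theorem mem_curvatureValues {w A B : Fin 2 → Fin 2 → OneForm 4 𝔼}
    (hw : ∀ α i, (w α i).Smooth) (hA : ∀ α β, (A α β).Smooth) (hB : ∀ j i, (B j i).Smooth)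
    (e : ∀ n : 𝔼, TangentSpace (𝓡 4) n ≃ₗ[ℝ] Coords) (he : ∀ n v α i, e n v α i = w α i n v)
    (trace_A : ∀ n v, ∑ γ, A γ γ n v = 0) (trace_B : ∀ n v, ∑ k, B k k n v = 0)
    {b₁ b₂ : Array6} (b₁_skew : ∀ j k l i γ δ, b₁ j k l i γ δ = - b₁ j l k i δ γ)
    (b₂_skew : ∀ α k l β γ δ, b₂ α k l β γ δ = - b₂ α l k β δ γ)
    (normal : ∀ k l γ δ, (∑ α, b₂ α k l γ α δ) - (∑ i, b₁ k i l i γ δ)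
      + (∑ α, b₂ α l k δ α γ) - (∑ i, b₁ l i k i δ γ) = 0)
    (d_w : ∀ n u v α i, (w α i).extD n u v
      = ∑ j, wedge (w α j) (B j i) n u v + ∑ β, wedge (A α β) (w β i) n u v)
    (d_A : ∀ n u v α β, (A α β).extD n u v = ∑ γ, wedge (A α γ) (A γ β) n u v
        + ∑ k, ∑ l, ∑ γ, ∑ δ, b₂ α k l β γ δ * wedge (w γ k) (w δ l) n u v)
    (d_B : ∀ n u v j i, (B j i).extD n u v = ∑ k, wedge (B j k) (B k i) n u v
        + ∑ k, ∑ l, ∑ γ, ∑ δ, b₁ j k l i γ δ * wedge (w γ k) (w δ l) n u v) :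
    (b₁.components, b₂.components) ∈ curvatureValues := by
  let S : AlmostGrassmann13 𝔼 :=
    { cone := fun x => {v | ∃ t s : Fin 2 → ℝ, ∀ α i, e x v α i = t α * s i}
      exists_coframe := fun _ => ⟨Set.univ, isOpen_univ, trivial, w, hw,
        fun x _ => ⟨e x, he x, rfl⟩⟩ }
  let F : AGStructureForms S 4 𝔼 :=
    { π := id
      contMDiff_π := contMDiff_id
      submersion := fun n => by rw [mfderiv_id]; exact Function.surjective_id
      frame := e
      adapted := fun _ => rfl
      w := w
      w_apply := fun n v α i => by rw [mfderiv_id]; exact (he n v α i).symm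
      A := A
      B := B
      -- With ω = 0 and ω_i^α = 0, the first three structure equations become those of a
      -- torsion-free linear connection, and the last two become trivial.
      o := 0
      z := 0
      smooth_w := hw
      smooth_A := hA
      smooth_B := hB
      smooth_o := smooth_zero
      smooth_z := fun _ _ => smooth_zero
      trace_A := trace_A
      trace_B := trace_B
      a := fun _ _ _ _ _ _ _ => 0
      b₁ := fun _ => b₁
      b₂ := fun _ => b₂
      c := fun _ _ _ _ _ _ _ => 0
      a_skew := by simp
      b₁_skew := fun _ => b₁_skew
      b₂_skew := fun _ => b₂_skew
      c_skew := by simp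
      d_w := fun n u v α i => by
        rw [d_w n u v α i]
        simp only [zero_wedge, zero_mul, Finset.sum_const_zero]
        ring
      d_A := fun n u v α β => by
        rw [d_A n u v α β]
        simp only [Pi.zero_apply, wedge_zero, Finset.sum_const_zero]
        ring
      d_B := fun n u v j i => by
        rw [d_B n u v j i]
        simp only [Pi.zero_apply, zero_wedge, Finset.sum_const_zero]
        ring
      d_o := fun n u v => by
        simp only [Pi.zero_apply, extD_zero, zero_wedge, Finset.sum_const_zero]
      d_z := fun n u v i α => by
        simp only [Pi.zero_apply, extD_zero, zero_wedge, wedge_zero, zero_mul,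
          Finset.sum_const_zero]
        ring
      a_trace₁ := by simp
      a_trace₂ := by simp
      b_normal := fun _ => normal }
  exact ⟨𝔼, inferInstance, inferInstance, inferInstance, S, 4, 𝔼, inferInstance, inferInstance,
    inferInstance, F, 0, rfl⟩

/-! ### Plane waves realizing fourth powers of linear forms -/

/-- The coordinates `x_α^i` on `ℝ⁴`. -/
def coordsEquiv : 𝔼 ≃ₗ[ℝ] Coords :=
  (EuclideanSpace.equiv (Fin 4) ℝ).toLinearEquiv ≪≫ₗ
    LinearEquiv.funCongrLeft ℝ ℝ finProdFinEquiv ≪≫ₗ LinearEquiv.curry ℝ ℝ (Fin 2) (Fin 2)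

/-- The coordinate `x_α^i` on `ℝ⁴` as a linear form. -/
def coord (α i : Fin 2) : 𝔼 →L[ℝ] ℝ :=
  EuclideanSpace.proj (finProdFinEquiv (α, i))

/-- The linear automorphism `1 + N` of `V` defined by an endomorphism `N` with `N² = 0`. -/
def onePlusEquiv {V : Type*} [AddCommGroup V] [Module ℝ V] (N : V →ₗ[ℝ] V)
    (hN : ∀ v, N (N v) = 0) : V ≃ₗ[ℝ] V :=
  LinearEquiv.ofLinearMap (1 + N) (1 - N) (by ext v; simp [hN]) (by ext v; simp [hN])

/-- The entries of the fourth power of the linear form with coefficients `1, x`. -/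
theorem quartic_pow (x : ℝ) (a b c d : Fin 2) :
    quartic (fun k => x ^ (k : ℕ)) a b c d
      = x ^ (a : ℕ) * x ^ (b : ℕ) * x ^ (c : ℕ) * x ^ (d : ℕ) := by
  simp [quartic, pow_add]

open OneForm

/-- The curvature tensor of the Latin plane wave in the direction `s`. -/
theorem latin_planeWave_mem (s : Fin 2 → ℝ) :
    (Array6.components fun j k l i γ δ =>
      eps γ δ * (eps i (i + 1) * (s j * s k * s l * s (i + 1))),
      Array6.components fun _ _ _ _ _ _ => 0) ∈ curvatureValues := by
  -- The conformal metric det(ω_α^i) of this wave is the flat one plus p²σ². Since ε^{ij} s_i s_j =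
  -- 0, the correction to the coframe drops out of s_i ω_1^i = dp. The connection matrix is a
  -- nilpotent matrix times σ, so its quadratic term vanishes and its curvature is a multiple of dp
  -- ∧ σ.
  let p : 𝔼 →L[ℝ] ℝ := ∑ j, s j • coord 1 j
  let σ : 𝔼 →L[ℝ] ℝ := ∑ j, s j • coord 0 j
  have hp (n : 𝔼) (u : TangentSpace (𝓡 4) n) : const p n u
      = s 0 * const (coord 1 0) n u + s 1 * const (coord 1 1) n u := const_sum_smul s _ n u
  have hσ (n : 𝔼) (u : TangentSpace (𝓡 4) n) : const σ n u
      = s 0 * const (coord 0 0) n u + s 1 * const (coord 0 1) n u := const_sum_smul s _ n u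
  let N (n : 𝔼) : Coords →ₗ[ℝ] Coords :=
    { toFun := fun c α i =>
        kron α 1 * eps i (i + 1) * s (i + 1) * -(p n ^ 2) * (s 0 * c 0 0 + s 1 * c 0 1)
      map_add' := fun c c' => by
        funext α i
        simp only [Pi.add_apply]
        ring
      map_smul' := fun r c => by
        funext α i
        simp only [Pi.smul_apply, smul_eq_mul, RingHom.id_apply]
        ring }
  -- `N n` reads only the row α = 0 and writes only the row α = 1, so its square is zero.
  have hN (n : 𝔼) (c : Coords) : N n (N n c) = 0 := by
    funext α i
    simp [N]
  have hq (c : ℝ) : ContDiff ℝ ∞ fun n => c * p n ^ 2 := by fun_prop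
  have hl (c : ℝ) : ContDiff ℝ ∞ fun n => c * p n := by fun_prop
  refine mem_curvatureValues
    (w := fun α i => affine (coord α i) σ
      fun n => -(kron α 1 * eps i (i + 1) * s (i + 1)) * p n ^ 2)
    (A := fun _ _ => 0)
    (B := fun j i => affine 0 σ fun n => -2 * s j * eps i (i + 1) * s (i + 1) * p n)
    (fun α i => smooth_affine _ _ (hq _)) (fun _ _ => smooth_zero)
    (fun j i => smooth_affine _ _ (hl _)) (fun n => coordsEquiv ≪≫ₗ onePlusEquiv (N n) (hN n))
    ?_ (by simp) ?_ ?_ (by simp) ?_ ?_ ?_ ?_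
  · intro n v α i
    rw [affine_apply, const_sum_smul]
    change coord α i v + kron α 1 * eps i (i + 1) * s (i + 1) * -(p n ^ 2) *
      (s 0 * coord 0 0 v + s 1 * coord 0 1 v) = coord α i v + _ *
      (s 0 * coord 0 0 v + s 1 * coord 0 1 v)
    ring
  · intro n v
    simp only [Fin.sum_univ_two, affine_apply, const_zero_apply, zero_add,
      Fin.one_add_one_of_two, eps_zero_one, eps_one_zero]
    ring
  · intro j k l i γ δ
    simp only [eps]
    ring
  · intro k l γ δ
    simp only [Fin.sum_univ_two, zero_add, Fin.one_add_one_of_two, eps_zero_one, eps_one_zero]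
    ring
  · intro n u v α i
    rw [extD_affine _ _ (hq _) (hasFDerivAt_quadratic _ p n)]
    simp only [zero_wedge, Finset.sum_const_zero]
    simp only [wedge, Fin.sum_univ_two, affine_apply, const_zero_apply, hp, hσ, zero_add]
    obtain rfl | rfl : α = 0 ∨ α = 1 := by omega
    all_goals
      simp only [kron_zero_one, kron_self]
      ring
  · intro n u v α β
    have h := extD_zero n u v
    simp only [zero_wedge, h, zero_mul, Finset.sum_const_zero, add_zero]
  · intro n u v j i
    rw [extD_affine _ _ (hl _) (hasFDerivAt_linear _ p n)]
    simp only [wedge, Fin.sum_univ_two, affine_apply, const_zero_apply, hp, hσ, zero_add,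
      kron_zero_one, kron_self, eps_self, eps_zero_one, eps_one_zero,
      Fin.one_add_one_of_two]
    ring

/-- The curvature tensor of the Greek plane wave in the direction `t`. -/
theorem greek_planeWave_mem (t : Fin 2 → ℝ) :
    (Array6.components fun _ _ _ _ _ _ => 0, Array6.components fun α k l β γ δ =>
      eps k l * (eps α (α + 1) * (t β * t γ * t δ * t (α + 1)))) ∈ curvatureValues := by
  -- The Latin wave with the index types exchanged. The coframe correction changes sign because the
  -- connection form ω_α^β stands to the left of ω_β^i, whereas ω_j^i stands to the right of ω_α^j.
  let p : 𝔼 →L[ℝ] ℝ := ∑ α, t α • coord α 1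
  let τ : 𝔼 →L[ℝ] ℝ := ∑ α, t α • coord α 0
  have hp (n : 𝔼) (u : TangentSpace (𝓡 4) n) : const p n u
      = t 0 * const (coord 0 1) n u + t 1 * const (coord 1 1) n u :=
    const_sum_smul t (coord · 1) n u
  have hτ (n : 𝔼) (u : TangentSpace (𝓡 4) n) : const τ n u
      = t 0 * const (coord 0 0) n u + t 1 * const (coord 1 0) n u :=
    const_sum_smul t (coord · 0) n u
  let N (n : 𝔼) : Coords →ₗ[ℝ] Coords :=
    { toFun := fun c α i =>
        kron i 1 * eps α (α + 1) * t (α + 1) * p n ^ 2 * (t 0 * c 0 0 + t 1 * c 1 0)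
      map_add' := fun c c' => by
        funext α i
        simp only [Pi.add_apply]
        ring
      map_smul' := fun r c => by
        funext α i
        simp only [Pi.smul_apply, smul_eq_mul, RingHom.id_apply]
        ring }
  have hN (n : 𝔼) (c : Coords) : N n (N n c) = 0 := by
    funext α i
    simp [N]
  have hq (c : ℝ) : ContDiff ℝ ∞ fun n => c * p n ^ 2 := by fun_prop
  have hl (c : ℝ) : ContDiff ℝ ∞ fun n => c * p n := by fun_prop
  refine mem_curvatureValues
    (w := fun α i => affine (coord α i) τ
      fun n => kron i 1 * eps α (α + 1) * t (α + 1) * p n ^ 2)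
    (A := fun α β => affine 0 τ fun n => -2 * t β * eps α (α + 1) * t (α + 1) * p n)
    (B := fun _ _ => 0)
    (fun α i => smooth_affine _ _ (hq _)) (fun j i => smooth_affine _ _ (hl _))
    (fun _ _ => smooth_zero) (fun n => coordsEquiv ≪≫ₗ onePlusEquiv (N n) (hN n))
    ?_ ?_ (by simp) (by simp) ?_ ?_ ?_ ?_ ?_
  · intro n v α i
    rw [affine_apply, const_sum_smul]
    rfl
  · intro n v
    simp only [Fin.sum_univ_two, affine_apply, const_zero_apply, zero_add,
      Fin.one_add_one_of_two, eps_zero_one, eps_one_zero]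
    ring
  · intro α k l β γ δ
    simp only [eps]
    ring
  · intro k l γ δ
    simp only [Fin.sum_univ_two, zero_add, Fin.one_add_one_of_two, eps_zero_one, eps_one_zero]
    ring
  · intro n u v α i
    rw [extD_affine _ _ (hq _) (hasFDerivAt_quadratic _ p n)]
    simp only [wedge_zero, Finset.sum_const_zero]
    simp only [wedge, Fin.sum_univ_two, affine_apply, const_zero_apply, hp, hτ, zero_add]
    obtain rfl | rfl : i = 0 ∨ i = 1 := by omega
    all_goals
      simp only [kron_zero_one, kron_self]
      ring
  · intro n u v α β
    rw [extD_affine _ _ (hl _) (hasFDerivAt_linear _ p n)]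
    simp only [wedge, Fin.sum_univ_two, affine_apply, const_zero_apply, hp, hτ, zero_add,
      kron_zero_one, kron_self, eps_self, eps_zero_one, eps_one_zero,
      Fin.one_add_one_of_two]
    ring
  · intro n u v j i
    have h := extD_zero n u v
    simp only [zero_wedge, h, zero_mul, Finset.sum_const_zero, add_zero]

/-! ### The span of the curvature tensors -/

/-- The fourth powers of linear forms span the binary quartic forms. -/
theorem span_range_pow : Submodule.span ℝ
    (Set.range fun (x : ℝ) (k : Fin 5) => x ^ (k : ℕ)) = ⊤ := by
  -- The five nodes 0, …, 4 are distinct, so the Vandermonde rows already form a basis.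
  let v : Fin 5 → ℝ := fun i => (i : ℕ)
  have hv : Function.Injective v := fun i j h => Fin.ext (Nat.cast_injective (R := ℝ) h)
  have hli : LinearIndependent ℝ (Matrix.vandermonde v).row :=
    Matrix.linearIndependent_rows_of_det_ne_zero (Matrix.det_vandermonde_ne_zero_iff.2 hv)
  rw [eq_top_iff, ← hli.span_eq_top_of_card_eq_finrank (by simp)]
  refine Submodule.span_mono ?_
  rintro _ ⟨i, rfl⟩
  exact ⟨v i, rfl⟩

/-- The pair of arrays attached to a pair of binary quartic forms, as a linear map. -/
def weylMap : (Fin 5 → ℝ) × (Fin 5 → ℝ) →ₗ[ℝ]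
    (Fin 2 × Fin 2 × Fin 2 × Fin 2 × Fin 2 × Fin 2 → ℝ) ×
      (Fin 2 × Fin 2 × Fin 2 × Fin 2 × Fin 2 × Fin 2 → ℝ) where
  toFun q := (Array6.components (latinWeyl q.1), Array6.components (greekWeyl q.2))
  map_add' q q' := by
    ext <;> simp [Array6.components, latinWeyl, greekWeyl, quartic, mul_add]
  map_smul' r q := by
    ext <;> simp [Array6.components, latinWeyl, greekWeyl, quartic, mul_left_comm]

theorem weylMap_injective : Function.Injective weylMap := by
  rw [← LinearMap.ker_eq_bot, LinearMap.ker_eq_bot']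
  rintro ⟨ψ, φ⟩ h
  have h₁ (j k l i γ δ : Fin 2) : latinWeyl ψ j k l i γ δ = 0 :=
    congrFun (congrArg Prod.fst h) (j, k, l, i, γ, δ)
  have h₂ (j k l i γ δ : Fin 2) : greekWeyl φ j k l i γ δ = 0 :=
    congrFun (congrArg Prod.snd h) (j, k, l, i, γ, δ)
  have a0 := h₁ 0 0 0 1 0 1
  have a1 := h₁ 0 0 0 0 0 1
  have a2 := h₁ 0 0 1 0 0 1
  have a3 := h₁ 0 1 1 0 0 1
  have a4 := h₁ 1 1 1 0 0 1
  have c0 := h₂ 1 0 1 0 0 0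
  have c1 := h₂ 0 0 1 0 0 0
  have c2 := h₂ 0 0 1 0 0 1
  have c3 := h₂ 0 0 1 0 1 1
  have c4 := h₂ 0 0 1 1 1 1
  simp [latinWeyl, greekWeyl, quartic] at a0 a1 a2 a3 a4 c0 c1 c2 c3 c4
  ext k <;> fin_cases k <;> assumption

/-- On each summand it suffices to treat fourth powers of the forms with coefficients (1, x), which
are the values of the plane waves in the direction (1, x). -/
theorem range_weylMap_le : LinearMap.range weylMap ≤ Submodule.span ℝ curvatureValues := by
  have h₁ : LinearMap.range (weylMap ∘ₗ LinearMap.inl ℝ (Fin 5 → ℝ) (Fin 5 → ℝ))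
      ≤ Submodule.span ℝ curvatureValues := by
    rw [LinearMap.range_eq_map, ← span_range_pow, Submodule.map_span, Submodule.span_le]
    rintro _ ⟨_, ⟨x, rfl⟩, rfl⟩
    refine Submodule.subset_span ?_
    convert! latin_planeWave_mem fun a => x ^ (a : ℕ) using 2
    · funext q
      simp only [Array6.components, ← quartic_pow]
      rfl
    · funext q
      simp [weylMap, Array6.components, greekWeyl, quartic]
  have h₂ : LinearMap.range (weylMap ∘ₗ LinearMap.inr ℝ (Fin 5 → ℝ) (Fin 5 → ℝ))
      ≤ Submodule.span ℝ curvatureValues := by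
    rw [LinearMap.range_eq_map, ← span_range_pow, Submodule.map_span, Submodule.span_le]
    rintro _ ⟨_, ⟨x, rfl⟩, rfl⟩
    refine Submodule.subset_span ?_
    convert! greek_planeWave_mem fun a => x ^ (a : ℕ) using 2
    · funext q
      simp [weylMap, Array6.components, latinWeyl, quartic]
    · funext q
      simp only [Array6.components, ← quartic_pow]
      rfl
  rintro _ ⟨⟨ψ, φ⟩, rfl⟩
  have h : weylMap (ψ, φ) = weylMap (ψ, 0) + weylMap (0, φ) := by
    rw [← map_add, Prod.mk_add_mk, add_zero, zero_add]
  rw [h]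
  exact add_mem (h₁ ⟨ψ, rfl⟩) (h₂ ⟨φ, rfl⟩)

theorem span_curvatureValues : Submodule.span ℝ curvatureValues = LinearMap.range weylMap := by
  refine le_antisymm (Submodule.span_le.2 ?_) range_weylMap_le
  rintro _ ⟨M, _, _, _, S, m, N, _, _, _, F, n, rfl⟩
  obtain ⟨ψ, φ, h₁, h₂⟩ := F.eq_weyl n
  exact ⟨(ψ, φ), by rw [h₁, h₂]; rfl⟩

end

theorem theorem3p4 :
    (∀ (M : Type*) [TopologicalSpace M] [ChartedSpace (EuclideanSpace ℝ (Fin 4)) M]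
        [IsManifold (𝓡 4) ∞ M] (S : AlmostGrassmann13 M)
        (m : ℕ) (N : Type*) [TopologicalSpace N] [ChartedSpace (EuclideanSpace ℝ (Fin m)) N]
        [IsManifold (𝓡 m) ∞ N] (F : AGStructureForms S m N) (n : N) (b₁ b₂ : Array6),
        b₁ = F.b₁ n → b₂ = F.b₂ n →
      -- vanishing components
      (b₂ 2 3 3 1 2 1 = 0 ∧ b₁ 3 3 4 4 1 1 = 0 ∧ b₂ 1 3 3 2 1 2 = 0 ∧ b₁ 3 3 4 4 2 2 = 0 ∧
        b₂ 2 4 4 1 2 1 = 0 ∧ b₁ 4 4 3 3 1 1 = 0 ∧ b₂ 1 4 4 2 1 2 = 0 ∧ b₁ 4 4 3 3 2 2 = 0) ∧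
      (b₂ 1 3 3 1 1 2 = 0 ∧ b₂ 1 4 4 1 1 2 = 0 ∧ b₁ 4 4 3 4 1 1 = 0 ∧ b₁ 3 3 4 3 2 2 = 0) ∧
      -- coinciding components
      (b₁ 3 4 3 4 1 2 = b₁ 4 3 3 4 1 2 ∧ b₁ 4 3 3 4 1 2 = b₁ 3 3 4 4 1 2) ∧
      (b₁ 4 4 3 3 2 1 = b₁ 3 4 4 3 2 1 ∧ b₁ 3 4 4 3 2 1 = b₁ 4 3 4 3 2 1) ∧
      (b₂ 2 4 3 2 1 1 = b₂ 2 4 3 1 1 2 ∧ b₂ 2 4 3 1 1 2 = b₂ 2 4 3 1 2 1) ∧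
      (b₂ 1 3 4 1 2 2 = b₂ 1 3 4 2 2 1 ∧ b₂ 1 3 4 2 2 1 = b₂ 1 3 4 2 1 2) ∧
      (b₂ 1 3 4 1 1 2 = b₂ 1 3 4 2 1 1 ∧ b₂ 1 3 4 2 1 1 = b₂ 1 3 4 1 2 1 ∧
        b₂ 1 3 4 1 2 1 = b₂ 2 4 3 1 2 2) ∧
      (b₁ 4 3 3 3 2 1 = b₁ 3 3 4 3 2 1 ∧ b₁ 3 3 4 3 2 1 = b₁ 3 4 3 3 2 1 ∧
        b₁ 3 4 3 3 2 1 = b₁ 3 4 4 4 1 2)) ∧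
    Module.finrank ℝ (Submodule.span ℝ curvatureValues) = 10 := by
  refine ⟨?_, ?_⟩
  · intro M _ _ _ S m N _ _ _ F n b₁ b₂ h₁ h₂
    obtain ⟨ψ, φ, hψ, hφ⟩ := F.eq_weyl n
    rw [h₁, h₂, hψ, hφ]
    -- The literals 2 and 4 are the index 0, and 1 and 3 the index 1. Each vanishing component
    -- contains ε with equal indices; each chain of equalities repeats one quartic coefficient with
    -- the same sign.
    simp [latinWeyl, greekWeyl, quartic]
  · rw [span_curvatureValues, LinearMap.finrank_range_of_inj weylMap_injective]
    simp
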